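/- Let $\mathfrak g\subset\mathfrak{gl}(n,\mathbb R)$ be a semisimple Lie algebra with complexification $\mathfrak g^{\mathbb C}=\mathfrak g+\sqrt{-1}\,\mathfrak g\subset\mathfrak{gl}(n,\mathbb C)$, let $G^{\mathbb C}\subset \mathrm{GL}(n,\mathbb C)$ be the connected subgroup with Lie algebra $\mathfrak g^{\mathbb C}$ (the subgroup generated by $\exp(\mathfrak g^{\mathbb C})$), and let $\sigma$ be entrywise complex conjugation of matrices. Let $\mathfrak c$ be a Cartan subalgebra of $\mathfrak g$, that is, a maximal abelian subalgebra of $\mathfrak g$ which is ($\mathrm{ad}$-)diagonalizable in $\mathfrak g^{\mathbb C}$. Let $R$ be the set of (nonzero) roots of $\mathfrak c^{\mathbb C}$ in $\mathfrak g^{\mathbb C}$, with root spaces $(\mathfrak g^{\mathbb C})_\alpha$, and let $R^+\subset R$ be a positive system: for every root $\alpha$ exactly one of $\alpha,-\alpha$ lies in $R^+$, and if $\alpha,\beta\in R^+$ and $\alpha+\beta\in R$ then $\alpha+\beta\in R^+$. A simple root is an element of $R^+$ which is not a sum of two elements of $R^+$. Put $\mathfrak y=\sum_{\alpha\in R^+}(\mathfrak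 g^{\mathbb C})_\alpha$, the nilradical of the Borel subalgebra $\mathfrak b=\mathfrak c^{\mathbb C}+\mathfrak y$. For a complex linear function $\lambda$ on $\mathfrak c^{\mathbb C}$ let $p(\lambda)(H)=\overline{\lambda(\sigma(H))}$; for a root $\alpha$ let $H_\alpha\in[(\mathfrak g^{\mathbb C})_\alpha,(\mathfrak g^{\mathbb C})_{-\alpha}]$ be the coroot, determined by $\alpha(H_\alpha)=2$, and let $s_\alpha(\lambda)=\lambda-\lambda(H_\alpha)\alpha$. Consider the following algorithm. Start with the empty sequence of simple roots; given $\beta_1,\dots,\beta_k$, if there is a simple root $\alpha$ such that $p(s_{\beta_1}\cdots s_{\beta_k}\alpha)\in -R^+$, choose any such $\alpha$, put $\beta_{k+1}=\alpha$ and continue; otherwise stop. Then the algorithm stops, whatever choices are made, after at most $\#\{\alpha\in R^+ : p(\alpha)\in -R^+\}$ steps, and each of its outputs $\beta_1,\dots,\beta_l$ satisfies $$p(s_{\beta_1}\cdots s_{\beta_l}(R^+))=R^+,\qquad s_{\beta_1}\cdots s_{\beta_l}(R^+)=p(R^+).$$ For every simple root $\alpha$ there are $X_\alpha\in(\mathfrak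 g^{\mathbb C})_\alpha$ and $X_{-\alpha}\in(\mathfrak g^{\mathbb C})_{-\alpha}$ with $[X_\alpha,X_{-\alpha}]\ne 0$, $[[X_\alpha,X_{-\alpha}],X_\alpha]=2X_\alpha$ and $[[X_\alpha,X_{-\alpha}],X_{-\alpha}]=-2X_{-\alpha}$. For every output $\beta_1,\dots,\beta_l$ and every choice of such $X_{\pm\alpha}$ for the simple roots $\alpha$, let $$w_\alpha=\exp(X_\alpha)\exp(-X_{-\alpha})\exp(X_\alpha),\qquad \omega=w_{\beta_1}\cdots w_{\beta_l}.$$ Then $\omega$ lies in $G^{\mathbb C}$ and normalizes $\mathfrak c^{\mathbb C}$, that is, $\omega\,\mathfrak c^{\mathbb C}\,\omega^{-1}=\mathfrak c^{\mathbb C}$; it represents $s_{\beta_1}\cdots s_{\beta_l}$, that is, $\lambda(\omega^{-1}H\omega)=(s_{\beta_1}\cdots s_{\beta_l}\lambda)(H)$ for all $H\in\mathfrak c^{\mathbb C}$ and all complex linear functions $\lambda$ on $\mathfrak c^{\mathbb C}$; and $$\omega\,\mathfrak y\,\omega^{-1}=\sigma(\mathfrak y).$$ -/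

import Mathlib

attribute [local instance 100] LieRing.ofAssociativeRing

namespace RealSemisimple

noncomputable section

/-- Real `n × n` matrices. -/
abbrev MatR (n : ℕ) := Matrix (Fin n) (Fin n) ℝ

/-- Complex `n × n` matrices. -/
abbrev MatC (n : ℕ) := Matrix (Fin n) (Fin n) ℂ

/-- The complexification `a + √-1 a ⊆ 𝔤𝔩(n, ℂ)` of a real Lie algebra of matrices `a ⊆ 𝔤𝔩(n, ℝ)`:
the complex matrices whose real part and imaginary part both lie in `a`. -/
def complexification {n : ℕ} (a : LieSubalgebra ℝ (MatR n)) : LieSubalgebra ℂ (MatC n) where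
  carrier := {Z | Z.map Complex.re ∈ a ∧ Z.map Complex.im ∈ a}
  add_mem' := by
    rintro Z W ⟨h1, h2⟩ ⟨h3, h4⟩
    have e1 : (Z + W).map Complex.re = Z.map Complex.re + W.map Complex.re := by
      ext i j; simp
    have e2 : (Z + W).map Complex.im = Z.map Complex.im + W.map Complex.im := by
      ext i j; simp
    exact ⟨e1 ▸ add_mem h1 h3, e2 ▸ add_mem h2 h4⟩
  zero_mem' := by
    have e1 : (0 : MatC n).map Complex.re = 0 := by ext i j; simp
    have e2 : (0 : MatC n).map Complex.im = 0 := by ext i j; simp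
    exact ⟨e1 ▸ a.zero_mem, e2 ▸ a.zero_mem⟩
  smul_mem' := by
    rintro z Z ⟨h1, h2⟩
    have e1 : (z • Z).map Complex.re = z.re • Z.map Complex.re - z.im • Z.map Complex.im := by
      ext i j; simp
    have e2 : (z • Z).map Complex.im = z.re • Z.map Complex.im + z.im • Z.map Complex.re := by
      ext i j; simp
    exact ⟨e1 ▸ sub_mem (a.smul_mem _ h1) (a.smul_mem _ h2),
      e2 ▸ add_mem (a.smul_mem _ h2) (a.smul_mem _ h1)⟩
  lie_mem' := by
    rintro Z W ⟨h1, h2⟩ ⟨h3, h4⟩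
    have e1 : (⁅Z, W⁆ : MatC n).map Complex.re
        = ⁅Z.map Complex.re, W.map Complex.re⁆ - ⁅Z.map Complex.im, W.map Complex.im⁆ := by
      ext i j
      simp [Ring.lie_def, Matrix.mul_apply, Finset.sum_sub_distrib]
      ring
    have e2 : (⁅Z, W⁆ : MatC n).map Complex.im
        = ⁅Z.map Complex.re, W.map Complex.im⁆ + ⁅Z.map Complex.im, W.map Complex.re⁆ := by
      ext i j
      simp [Ring.lie_def, Matrix.mul_apply, Finset.sum_add_distrib]
      ring
    exact ⟨e1 ▸ sub_mem (a.lie_mem h1 h3) (a.lie_mem h2 h4),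
      e2 ▸ add_mem (a.lie_mem h1 h4) (a.lie_mem h2 h3)⟩

/-- Complex conjugation `σ` of matrices, entry by entry. -/
def conjMat {n : ℕ} (Z : MatC n) : MatC n := Z.map (starRingEnd ℂ)

theorem conjMat_mem {n : ℕ} {a : LieSubalgebra ℝ (MatR n)} {Z : MatC n}
    (hZ : Z ∈ complexification a) : conjMat Z ∈ complexification a := by
  obtain ⟨h1, h2⟩ := hZ
  have e1 : (conjMat Z).map Complex.re = Z.map Complex.re := by ext i j; simp [conjMat]
  have e2 : (conjMat Z).map Complex.im = -Z.map Complex.im := by ext i j; simp [conjMat]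
  exact ⟨e1 ▸ h1, e2 ▸ neg_mem h2⟩

/-- `c` is a Cartan subalgebra of `g`: a maximal abelian subalgebra of `g` which is diagonalizable
in the complexification of `g`, that is, the complexification of `g` is spanned by
simultaneous eigenvectors of all `ad h`, `h ∈ c`. -/
structure IsCartan {n : ℕ} (g c : LieSubalgebra ℝ (MatR n)) : Prop where
  maximal : Maximal (fun a : LieSubalgebra ℝ (MatR n) => a ≤ g ∧ IsLieAbelian a) c
  diagonalizable : (complexification g).toSubmodule ≤
    Submodule.span ℂ {v : MatC n | v ∈ complexification g ∧
      ∀ h ∈ c, ∃ z : ℂ, ⁅h.map Complex.ofReal, v⁆ = z • v}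

/-- Complex linear functions on the complexification of `c`. -/
abbrev CDual {n : ℕ} (c : LieSubalgebra ℝ (MatR n)) := Module.Dual ℂ (complexification c)

/-- The space of all `v` in the complexification of `g` with `[H, v] = α(H) v` for all `H` in the
complexification of `c`. -/
def rootSpace {n : ℕ} (g c : LieSubalgebra ℝ (MatR n)) (α : CDual c) : Submodule ℂ (MatC n) where
  carrier := {v | v ∈ complexification g ∧
    ∀ H : complexification c, ⁅(H : MatC n), v⁆ = α H • v}
  add_mem' := by
    rintro v w ⟨h1, h2⟩ ⟨h3, h4⟩
    exact ⟨add_mem h1 h3, fun H => by rw [lie_add, h2, h4, smul_add]⟩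
  zero_mem' := ⟨(complexification g).zero_mem, fun H => by simp⟩
  smul_mem' := by
    rintro z v ⟨h1, h2⟩
    exact ⟨(complexification g).smul_mem z h1, fun H => by rw [lie_smul, h2, smul_comm]⟩

/-- The roots of the complexification of `c` in the complexification of `g`. -/
def IsRoot {n : ℕ} (g c : LieSubalgebra ℝ (MatR n)) (α : CDual c) : Prop :=
  α ≠ 0 ∧ rootSpace g c α ≠ ⊥

/-- `P` is a positive system of roots. -/
structure IsPositiveSystem {n : ℕ} (g c : LieSubalgebra ℝ (MatR n)) (P : Set (CDual c)) :
    Prop where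
  isRoot : ∀ α ∈ P, IsRoot g c α
  mem_or_neg_mem : ∀ α, IsRoot g c α → α ∈ P ∨ -α ∈ P
  neg_notMem : ∀ α ∈ P, -α ∉ P
  add_mem : ∀ α ∈ P, ∀ β ∈ P, IsRoot g c (α + β) → α + β ∈ P

/-- A simple root: a positive root which is not the sum of two positive roots. -/
def IsSimpleRoot {n : ℕ} {c : LieSubalgebra ℝ (MatR n)} (P : Set (CDual c)) (α : CDual c) : Prop :=
  α ∈ P ∧ ∀ β ∈ P, ∀ γ ∈ P, α ≠ β + γ

/-- The sum `𝔶` of the root spaces of the positive roots; this is the nilradical of the Borel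
subalgebra `𝔠^ℂ + 𝔶`. -/
def positiveSum {n : ℕ} (g : LieSubalgebra ℝ (MatR n)) {c : LieSubalgebra ℝ (MatR n)}
    (P : Set (CDual c)) : Submodule ℂ (MatC n) :=
  ⨆ α ∈ P, rootSpace g c α

/-- The conjugate `λ^σ(H) = conj (λ (σ H))` of a complex linear function `λ`. -/
def conjDual {n : ℕ} {c : LieSubalgebra ℝ (MatR n)} (l : CDual c) : CDual c where
  toFun H := starRingEnd ℂ (l ⟨conjMat (H : MatC n), conjMat_mem H.2⟩)
  map_add' H K := by
    have e : (⟨conjMat ((H + K : complexification c) : MatC n), conjMat_mem (H + K).2⟩ :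
        complexification c) = ⟨conjMat (H : MatC n), conjMat_mem H.2⟩
          + ⟨conjMat (K : MatC n), conjMat_mem K.2⟩ := by
      apply Subtype.ext; ext i j; simp [conjMat]
    rw [e, map_add, map_add]
  map_smul' z H := by
    have e : (⟨conjMat ((z • H : complexification c) : MatC n), conjMat_mem (z • H).2⟩ :
        complexification c) = (starRingEnd ℂ z) • ⟨conjMat (H : MatC n), conjMat_mem H.2⟩ := by
      apply Subtype.ext; ext i j; simp [conjMat]
    rw [e, map_smul]; simp

/-- The coroot `H_α`: the element of `[𝔤_α, 𝔤_{-α}]` on which `α` takes the value `2`. -/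
def coroot {n : ℕ} (g : LieSubalgebra ℝ (MatR n)) {c : LieSubalgebra ℝ (MatR n)} (α : CDual c) :
    complexification c :=
  Classical.epsilon fun H : complexification c =>
    (∃ x ∈ rootSpace g c α, ∃ y ∈ rootSpace g c (-α), (H : MatC n) = ⁅x, y⁆) ∧ α H = 2

/-- The reflection `λ ↦ λ - λ(H_α) α` in the root `α`. -/
def reflect {n : ℕ} (g : LieSubalgebra ℝ (MatR n)) {c : LieSubalgebra ℝ (MatR n)}
    (α l : CDual c) : CDual c :=
  l - l (coroot g α) • α

/-- The action on `λ` of the product of the reflections in the roots `β₁, …, β_l`, the last one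
being applied first. -/
def weylWord {n : ℕ} (g : LieSubalgebra ℝ (MatR n)) {c : LieSubalgebra ℝ (MatR n)}
    (β : List (CDual c)) (l : CDual c) : CDual c :=
  β.foldr (reflect g) l

/-- The partial runs of the algorithm that produces the sequence `β₁, …, β_l`: start with
the empty sequence; as long as there is a simple root `α` such that
`σ(s_{β₁} ⋯ s_{β_k} α)` is negative, append one such `α` to the sequence. -/
inductive IsRun {n : ℕ} (g : LieSubalgebra ℝ (MatR n)) {c : LieSubalgebra ℝ (MatR n)}
    (P : Set (CDual c)) : List (CDual c) → Prop
  | nil : IsRun g P []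
  | snoc (β : List (CDual c)) (α : CDual c) (hβ : IsRun g P β) (hα : IsSimpleRoot P α)
      (hneg : -conjDual (weylWord g β α) ∈ P) : IsRun g P (β ++ [α])

/-- `β` is an output of the algorithm: a run at which the algorithm has stopped. -/
def IsOutput {n : ℕ} (g : LieSubalgebra ℝ (MatR n)) {c : LieSubalgebra ℝ (MatR n)}
    (P : Set (CDual c)) (β : List (CDual c)) : Prop :=
  IsRun g P β ∧ ¬ ∃ α, IsSimpleRoot P α ∧ -conjDual (weylWord g β α) ∈ P

/-- The matrix exponential with values in `GL(n, ℂ)`. -/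
def expGL {n : ℕ} (Z : MatC n) : GL (Fin n) ℂ :=
  (Matrix.isUnit_exp Z).unit

/-- The connected subgroup of `GL(n, ℂ)` with Lie algebra the complexification of `g`, that is,
the subgroup generated by the exponentials of the elements of this Lie algebra. -/
def complexGroup {n : ℕ} (g : LieSubalgebra ℝ (MatR n)) : Subgroup (GL (Fin n) ℂ) :=
  Subgroup.closure (expGL '' {Z : MatC n | Z ∈ complexification g})

/-- The image `k S k⁻¹` of a set of matrices under conjugation by `k`. -/
def conjugate {n : ℕ} (k : GL (Fin n) ℂ) (S : Set (MatC n)) : Set (MatC n) :=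
  (fun Z => (k : MatC n) * Z * ((k⁻¹ : GL (Fin n) ℂ) : MatC n)) '' S

/-- `X = X_α` and `Y = X_{-α}` are root vectors for `α` and `-α` which generate a standard copy
of `𝔰𝔩(2, ℂ)`, with `H_α = [X_α, X_{-α}]`. -/
structure IsStandardPair {n : ℕ} (g c : LieSubalgebra ℝ (MatR n)) (α : CDual c)
    (X Y : MatC n) : Prop where
  mem_pos : X ∈ rootSpace g c α
  mem_neg : Y ∈ rootSpace g c (-α)
  triple : IsSl2Triple ⁅X, Y⁆ X Y

/-- The element `exp(X) exp(-Y) exp(X)`. -/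
def weylRep {n : ℕ} (X Y : MatC n) : GL (Fin n) ℂ :=
  expGL X * expGL (-Y) * expGL X

/-- The product `ω = w_{β₁} ⋯ w_{β_l}`, where `w_α = exp(X_α) exp(-X_{-α}) exp(X_α)`. -/
def omega {n : ℕ} {c : LieSubalgebra ℝ (MatR n)} (X Y : CDual c → MatC n)
    (β : List (CDual c)) : GL (Fin n) ℂ :=
  (β.map fun α => weylRep (X α) (Y α)).prod

end

end RealSemisimple

/-! Let w be the product of the reflections chosen so far and u = p ∘ w, which permutes the finite
set of roots. A simple reflection s_α sends α to -α and permutes the other positive roots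
(`simple_reflection_mem`). Hence, if u α is negative, passing from u to u ∘ s_α lowers the number of
positive roots made negative by exactly one (`ncard_comp_reflection`); this bounds the number of
steps. When no simple root is made negative, u P ⊆ P because positive roots arise from simple ones
by addition, and counting gives u P = P (`image_positive_eq`). As p is an involution, w P = p P.

A positive system is given here by closure alone, without an ordering functional. The substitute is
that a nonempty sum of positive roots never vanishes (`sum_ne_zero`).

The root axioms come from the structure theory over ℂ. The Killing form stays nondegenerate under
complexification (`isKilling_complexification`), and maximality together with diagonalizability
makes 𝔠^ℂ a Cartan subalgebra (`isCartanSubalgebra`), so the theory of Killing Lie algebras yields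
`isRootSet`.

On the group side, exponential series that break off show that w_α acts on 𝔠^ℂ as a reflection
(`conjL_weylRep`). Conjugation by ω therefore moves the root space of α to that of w α
(`Represents.map_rootSpace`), while σ moves it to that of p α (`map_conjMat_rootSpace`). Thus ω 𝔶
ω⁻¹ and σ(𝔶) are sums of root spaces over the same set w P = p P. -/

namespace RealSemisimple

/-! ### Combinatorics of positive systems and simple reflections -/

section RootSet

variable {V : Type*} [AddCommGroup V] [Module ℂ V]

/-- `Φ` is a finite reduced crystallographic set of roots in `V`, where `f α` is the pairing with
the coroot of `α`. -/
structure IsRootSet (Φ : Set V) (f : V → V →ₗ[ℂ] ℂ) : Prop where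
  finite : Φ.Finite
  zero_notMem : (0 : V) ∉ Φ
  neg_mem : ∀ α ∈ Φ, -α ∈ Φ
  self : ∀ α ∈ Φ, f α α = 2
  int : ∀ α ∈ Φ, ∀ β ∈ Φ, ∃ k : ℤ, f α β = k
  reflection_mem : ∀ α ∈ Φ, ∀ β ∈ Φ, β - f α β • α ∈ Φ
  sub_mem : ∀ α ∈ Φ, ∀ β ∈ Φ, ∀ k : ℤ, f α β = k → 0 < k → β ≠ α → β - α ∈ Φ
  two_nsmul_notMem : ∀ α ∈ Φ, α + α ∉ Φ

/-- `P` is a closed system of positive roots in `Φ`. -/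
structure IsPositive (Φ P : Set V) : Prop where
  subset : P ⊆ Φ
  mem_or_neg_mem : ∀ α ∈ Φ, α ∈ P ∨ -α ∈ P
  neg_notMem : ∀ α ∈ P, -α ∉ P
  add_mem : ∀ α ∈ P, ∀ β ∈ P, α + β ∈ Φ → α + β ∈ P

/-- A positive root which is not a sum of two positive roots. -/
def IsSimpleIn (P : Set V) (α : V) : Prop :=
  α ∈ P ∧ ∀ β ∈ P, ∀ γ ∈ P, α ≠ β + γ

variable {Φ P : Set V} {f : V → V →ₗ[ℂ] ℂ}

theorem IsRootSet.add_mem (h : IsRootSet Φ f) {α β : V} (hα : α ∈ Φ) (hβ : β ∈ Φ) {k : ℤ}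
    (hk : f α β = k) (hk0 : k < 0) (hne : β ≠ -α) : β + α ∈ Φ := by
  have h1 : α + β ∈ Φ := by
    have := h.sub_mem α hα (-β) (h.neg_mem β hβ) (-k) (by simp [hk]) (by omega)
      (fun e => hne (by rw [← e, neg_neg]))
    have := h.neg_mem _ this
    rwa [neg_sub, sub_neg_eq_add] at this
  rwa [add_comm]

/-- If the sum vanished, pairing it with the coroot of one term `a` would give 2 plus the other
pairings equal to 0, so some other term `b` pairs negatively with `a`. Then `b + a` is a positive
root, and merging the two terms gives a shorter vanishing sum. -/
theorem multiset_sum_ne_zero (h : IsRootSet Φ f) (hP : IsPositive Φ P) :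
    ∀ (m : ℕ) (s : Multiset V), s.card = m + 1 → (∀ x ∈ s, x ∈ P) → s.sum ≠ 0 := by
  intro m
  induction m with
  | zero =>
    intro s hs hsP h0
    obtain ⟨a, rfl⟩ := Multiset.card_eq_one.1 hs
    rw [Multiset.sum_singleton] at h0
    exact h.zero_notMem (h0 ▸ hP.subset (hsP a (by simp)))
  | succ m ih =>
    intro s hs hsP h0
    obtain ⟨a, t, rfl⟩ : ∃ a t, s = a ::ₘ t := by
      obtain ⟨a, ha⟩ := Multiset.card_pos_iff_exists_mem.1 (by omega : 0 < s.card)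
      exact ⟨a, Multiset.exists_cons_of_mem ha⟩
    have ha : a ∈ P := hsP a (by simp)
    have htP : ∀ x ∈ t, x ∈ P := fun x hx => hsP x (Multiset.mem_cons_of_mem hx)
    have hex : ∃ b ∈ t, ∃ k : ℤ, f a b = k ∧ k < 0 := by
      by_contra hcon
      push Not at hcon
      have hre : 0 ≤ ((t.map (f a)).map Complex.re).sum := by
        apply Multiset.sum_nonneg
        intro x hx
        simp only [Multiset.map_map, Multiset.mem_map, Function.comp] at hx
        obtain ⟨b, hb, rfl⟩ := hx
        obtain ⟨k, hk⟩ := h.int a (hP.subset ha) b (hP.subset (htP b hb))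
        rw [hk, Complex.intCast_re]
        exact_mod_cast hcon b hb k hk
      have h2 : f a a + (t.map (f a)).sum = 0 := by
        rw [← map_multiset_sum, ← map_add, ← Multiset.sum_cons, h0, map_zero]
      have h3 : ((t.map (f a)).map Complex.re).sum = (t.map (f a)).sum.re :=
        (map_multiset_sum Complex.reAddGroupHom _).symm
      rw [h3, eq_neg_of_add_eq_zero_right h2, h.self a (hP.subset ha)] at hre
      norm_num at hre
    obtain ⟨b, hb, k, hk, hk0⟩ := hex
    obtain ⟨u, rfl⟩ := Multiset.exists_cons_of_mem hb
    have hbP := htP b hb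
    have hab : b + a ∈ P := hP.add_mem b hbP a ha
      (h.add_mem (hP.subset ha) (hP.subset hbP) hk hk0 fun e => hP.neg_notMem a ha (e ▸ hbP))
    refine ih ((b + a) ::ₘ u) ?_ ?_ ?_
    · simp at hs ⊢; omega
    · intro x hx
      rcases Multiset.mem_cons.1 hx with rfl | hx
      · exact hab
      · exact htP x (Multiset.mem_cons_of_mem hx)
    · rw [← h0]; simp only [Multiset.sum_cons]; abel

/-- A nonempty sum of positive roots does not vanish. -/
theorem sum_ne_zero (h : IsRootSet Φ f) (hP : IsPositive Φ P) (s : Multiset V) (hs : s ≠ 0)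
    (hsP : ∀ x ∈ s, x ∈ P) : s.sum ≠ 0 := by
  obtain ⟨m, hm⟩ := Nat.exists_eq_succ_of_ne_zero (fun e => hs (Multiset.card_eq_zero.1 e))
  exact multiset_sum_ne_zero h hP m s hm hsP

/-- Induction on positive roots, from the simple ones by addition. -/
theorem positive_induction (h : IsRootSet Φ f) (hP : IsPositive Φ P) {Q : V → Prop}
    (simple : ∀ α, IsSimpleIn P α → Q α)
    (add : ∀ α ∈ P, ∀ β ∈ P, α + β ∈ P → Q α → Q β → Q (α + β)) : ∀ α ∈ P, Q α := by
  have hfin : P.Finite := h.finite.subset hP.subset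
  -- `S` contains every positive root lying below `α`, meaning that `α` exceeds it by a nonempty sum
  -- of positive roots. Passing to a summand `β` of `α` removes `β` itself from `S`, since by
  -- `sum_ne_zero` no root lies below itself.
  have key : ∀ S : Finset V, ∀ α ∈ P,
      (∀ β ∈ P, (∃ s : Multiset V, s ≠ 0 ∧ (∀ x ∈ s, x ∈ P) ∧ α = β + s.sum) → β ∈ S) → Q α := by
    intro S
    induction S using Finset.strongInduction with
    | H S ih =>
      intro α hα hS
      by_cases hs : IsSimpleIn P α
      · exact simple α hs
      have hs' : ∃ β ∈ P, ∃ γ ∈ P, α = β + γ := by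
        by_contra hcon
        push Not at hcon
        exact hs ⟨hα, hcon⟩
      have step : ∀ β ∈ P, ∀ γ ∈ P, α = β + γ → Q β := by
        intro β hβ γ hγ e
        classical
        refine ih (S.erase β) (Finset.erase_ssubset (hS β hβ ⟨{γ}, by simp, by simpa, by simpa⟩))
          β hβ ?_
        rintro δ hδ ⟨s, hs0, hsP, rfl⟩
        refine Finset.mem_erase.2 ⟨?_, hS δ hδ ⟨γ ::ₘ s, by simp, ?_, ?_⟩⟩
        · intro e'
          exact sum_ne_zero h hP s hs0 hsP (left_eq_add.1 e')
        · simpa using ⟨hγ, hsP⟩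
        · rw [e, Multiset.sum_cons]; abel
      obtain ⟨β, hβ, γ, hγ, rfl⟩ := hs'
      exact add β hβ γ hγ hα (step β hβ γ hγ rfl) (step γ hγ β hβ (add_comm _ _))
  intro α hα
  exact key hfin.toFinset α hα fun β hβ _ => hfin.mem_toFinset.2 hβ

/-- If the root `γ - α` were negative, then α = γ + (α - γ) would split the simple root. It is not
`α` because twice a root is never a root. -/
theorem sub_simple_mem (h : IsRootSet Φ f) (hP : IsPositive Φ P) {α γ : V} (hα : IsSimpleIn P α)
    (hγ : γ ∈ P) (hne : γ ≠ α) {k : ℤ} (hk : f α γ = k) (hk0 : 0 < k) :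
    γ - α ∈ P ∧ γ - α ≠ α := by
  have hr := h.sub_mem α (hP.subset hα.1) γ (hP.subset hγ) k hk hk0 hne
  refine ⟨?_, ?_⟩
  · rcases hP.mem_or_neg_mem _ hr with h1 | h1
    · exact h1
    · exact absurd (by abel) (hα.2 γ hγ _ h1)
  · intro e
    exact h.two_nsmul_notMem α (hP.subset hα.1) (by rw [← sub_eq_iff_eq_add.1 e]; exact hP.subset hγ)

/-- Pairing a supposed equality with the coroot of `α` makes the two pairings add up to a positive
number, so one of them is positive. Subtracting `α` from that summand keeps it positive and
different from `α`, and lowers `k`. -/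
theorem add_ne_nsmul_simple (h : IsRootSet Φ f) (hP : IsPositive Φ P) {α : V}
    (hα : IsSimpleIn P α) :
    ∀ k : ℕ, ∀ γ ∈ P, ∀ δ ∈ P, γ ≠ α → δ ≠ α → γ + δ ≠ k • α := by
  intro k
  induction k with
  | zero =>
    intro γ hγ δ hδ _ _ e
    refine sum_ne_zero h hP {γ, δ} (by simp) ?_ (by simpa using e)
    simpa using ⟨hγ, hδ⟩
  | succ k ih =>
    intro γ hγ δ hδ hne hne' e
    have hαΦ := hP.subset hα.1
    obtain ⟨a, ha⟩ := h.int α hαΦ γ (hP.subset hγ)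
    obtain ⟨b, hb⟩ := h.int α hαΦ δ (hP.subset hδ)
    have hab : a + b = 2 * (k + 1 : ℤ) := by
      have := congrArg (f α) e
      rw [map_add, ha, hb, map_nsmul, h.self α hαΦ] at this
      have h' : ((a + b : ℤ) : ℂ) = ((2 * (k + 1 : ℤ) : ℤ) : ℂ) := by
        push_cast; rw [this]; simp; ring
      exact_mod_cast h'
    by_cases ha0 : 0 < a
    · obtain ⟨h1, h2⟩ := sub_simple_mem h hP hα hγ hne ha ha0
      refine ih _ h1 δ hδ h2 hne' ?_
      rw [sub_add_eq_add_sub, e, succ_nsmul, add_sub_cancel_right]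
    · obtain ⟨h1, h2⟩ := sub_simple_mem h hP hα hδ hne' hb (by omega)
      refine ih γ hγ _ h1 hne h2 ?_
      rw [← add_sub_assoc, e, succ_nsmul, add_sub_cancel_right]

/-- The reflection in a simple root permutes the other positive roots. -/
theorem simple_reflection_mem (h : IsRootSet Φ f) (hP : IsPositive Φ P) {α γ : V}
    (hα : IsSimpleIn P α) (hγ : γ ∈ P) (hne : γ ≠ α) :
    γ - f α γ • α ∈ P ∧ γ - f α γ • α ≠ α := by
  have hαΦ := hP.subset hα.1
  obtain ⟨k, hk⟩ := h.int α hαΦ γ (hP.subset hγ)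
  have hne' : γ - f α γ • α ≠ α := by
    intro e
    have h1 := congrArg (f α) e
    rw [map_sub, map_smul, h.self α hαΦ, smul_eq_mul] at h1
    have h2 : f α γ = -2 := by linear_combination -h1
    rw [h2] at e
    have h3 : γ = -α := by
      calc γ = (γ - (-2 : ℂ) • α) - (2 : ℂ) • α := by module
        _ = -α := by rw [e]; module
    exact hP.neg_notMem α hα.1 (h3 ▸ hγ)
  refine ⟨?_, hne'⟩
  rcases hP.mem_or_neg_mem _ (h.reflection_mem α hαΦ γ (hP.subset hγ)) with h1 | h1
  · exact h1
  exfalso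
  rw [hk, Int.cast_smul_eq_zsmul] at h1
  set δ := -(γ - k • α) with hδ
  have hsum : γ + δ = k • α := by rw [hδ]; abel
  -- For `k < 0`, the sum of `γ`, `δ` and `-k` copies of `α` would be a vanishing sum of positive
  -- roots. For `k ≥ 0`, `add_ne_nsmul_simple` applies unless `δ = α`; then the pairings give k + 2
  -- = 2k, so k = 2 and `γ = α`, which is excluded.
  rcases lt_or_ge k 0 with hk0 | hk0
  · obtain ⟨m, hm⟩ := Int.eq_ofNat_of_zero_le (show 0 ≤ -k by omega)
    refine sum_ne_zero h hP (γ ::ₘ δ ::ₘ Multiset.replicate m α) (by simp) ?_ ?_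
    · intro x hx
      rcases Multiset.mem_cons.1 hx with rfl | hx
      · exact hγ
      rcases Multiset.mem_cons.1 hx with rfl | hx
      · exact h1
      · rw [Multiset.eq_of_mem_replicate hx]; exact hα.1
    · rw [Multiset.sum_cons, Multiset.sum_cons, Multiset.sum_replicate, ← add_assoc, hsum,
        ← natCast_zsmul, show ((m : ℕ) : ℤ) = -k from hm.symm, neg_zsmul, add_neg_cancel]
  · obtain ⟨m, rfl⟩ := Int.eq_ofNat_of_zero_le hk0
    refine add_ne_nsmul_simple h hP hα m γ hγ δ h1 hne ?_ (by simpa using hsum)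
    intro e
    have h2 := congrArg (f α) hsum
    rw [map_add, e, hk, h.self α hαΦ, map_zsmul, h.self α hαΦ] at h2
    have h3 : (m : ℂ) = 2 := by simp at h2; linear_combination -h2
    have h4 : m = 2 := by exact_mod_cast h3
    subst h4
    rw [e] at hsum
    apply hne
    have : γ = (2 : ℤ) • α - α := by rw [← sub_eq_iff_eq_add.2 hsum.symm]; rfl
    rw [this, two_zsmul, add_sub_cancel_right]

theorem reflection_involutive (h : IsRootSet Φ f) {α : V} (hα : α ∈ Φ) (γ : V) :
    (γ - f α γ • α) - f α (γ - f α γ • α) • α = γ := by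
  rw [map_sub, map_smul, h.self α hα, smul_eq_mul]
  module

/-- Composing on the right with a simple reflection whose root becomes negative lowers by one the
number of positive roots that become negative. -/
theorem ncard_comp_reflection (h : IsRootSet Φ f) (hP : IsPositive Φ P) {α : V}
    (hα : IsSimpleIn P α) (u : V →+ V) (hneg : -u α ∈ P) :
    {γ ∈ P | -u (γ - f α γ • α) ∈ P}.ncard + 1 = {γ ∈ P | -u γ ∈ P}.ncard := by
  have hαΦ := hP.subset hα.1
  have hfin : P.Finite := h.finite.subset hP.subset
  set s : V → V := fun γ => γ - f α γ • α with hs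
  have hss : ∀ γ, s (s γ) = γ := reflection_involutive h hαΦ
  have hsα : s α = -α := by
    simp only [hs, h.self α hαΦ]; module
  -- Away from `α` the involution `s` matches the two sets; `α` itself is counted for `u` but not
  -- for `u ∘ s`, because `s α = -α`.
  have hset : {γ ∈ P | -u γ ∈ P} = insert α (s '' {γ ∈ P | -u (s γ) ∈ P}) := by
    ext γ
    simp only [Set.mem_insert_iff, Set.mem_image, Set.mem_ofPred_eq]
    constructor
    · rintro ⟨h1, h2⟩
      by_cases e : γ = α
      · exact Or.inl e
      · exact Or.inr ⟨s γ, ⟨(simple_reflection_mem h hP hα h1 e).1, by rwa [hss]⟩, hss γ⟩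
    · rintro (rfl | ⟨δ, ⟨h1, h2⟩, rfl⟩)
      · exact ⟨hα.1, hneg⟩
      · refine ⟨(simple_reflection_mem h hP hα h1 ?_).1, h2⟩
        rintro rfl
        rw [hsα, map_neg, neg_neg] at h2
        exact hP.neg_notMem _ h2 hneg
  have hmem : α ∉ s '' {γ ∈ P | -u (s γ) ∈ P} := by
    rintro ⟨δ, ⟨h1, h2⟩, e⟩
    have : δ = -α := by rw [← hsα, ← e, hss]
    exact hP.neg_notMem α hα.1 (this ▸ h1)
  rw [hset, Set.ncard_insert_of_notMem hmem ((hfin.subset fun x hx => hx.1).image _),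
    Set.ncard_image_of_injective _ (Function.LeftInverse.injective hss)]

/-- An injective additive map which preserves the roots and makes no simple root negative
permutes the positive roots. -/
theorem image_positive_eq (h : IsRootSet Φ f) (hP : IsPositive Φ P) (u : V →+ V)
    (hu : Function.Injective u) (huΦ : ∀ α ∈ Φ, u α ∈ Φ)
    (hterm : ∀ α, IsSimpleIn P α → -u α ∉ P) : u '' P = P := by
  have hfin : P.Finite := h.finite.subset hP.subset
  refine Set.eq_of_subset_of_ncard_le ?_ (Set.ncard_image_of_injective P hu).ge hfin
  rintro _ ⟨α, hα, rfl⟩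
  refine positive_induction h hP (Q := fun α => u α ∈ P) ?_ ?_ α hα
  · intro α hα
    exact (hP.mem_or_neg_mem _ (huΦ α (hP.subset hα.1))).resolve_right (hterm α hα)
  · intro α _ β _ hαβ h1 h2
    rw [map_add]
    exact hP.add_mem _ h1 _ h2 (by rw [← map_add]; exact huΦ _ (hP.subset hαβ))

end RootSet

end RealSemisimple

namespace RealSemisimple

/-! ### The concrete complexification: Killing form and centralizer of the Cartan subalgebra -/

section Complexification

open scoped TensorProduct

variable {n : ℕ} {g c : LieSubalgebra ℝ (MatR n)}

theorem map_ofReal_lie (a b : MatR n) :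
    (⁅a, b⁆ : MatR n).map Complex.ofReal = ⁅a.map Complex.ofReal, b.map Complex.ofReal⁆ := by
  ext i j
  simp [Ring.lie_def, Matrix.mul_apply]

theorem map_re_add_map_im (Z : MatC n) :
    (Z.map Complex.re).map Complex.ofReal + Complex.I • (Z.map Complex.im).map Complex.ofReal
      = Z := by
  ext i j
  simp [mul_comm Complex.I, Complex.re_add_im]

theorem map_ofReal_mem {a : LieSubalgebra ℝ (MatR n)} {x : MatR n} (hx : x ∈ a) :
    x.map Complex.ofReal ∈ complexification a := by
  have e1 : (x.map Complex.ofReal).map Complex.re = x := by ext i j; simp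
  have e2 : (x.map Complex.ofReal).map Complex.im = 0 := by ext i j; simp
  exact ⟨e1 ▸ hx, e2 ▸ a.zero_mem⟩

theorem re_lie_map_ofReal (h : MatR n) (Z : MatC n) :
    (⁅h.map Complex.ofReal, Z⁆ : MatC n).map Complex.re = ⁅h, Z.map Complex.re⁆ := by
  ext i j
  simp [Ring.lie_def, Matrix.mul_apply]

theorem im_lie_map_ofReal (h : MatR n) (Z : MatC n) :
    (⁅h.map Complex.ofReal, Z⁆ : MatC n).map Complex.im = ⁅h, Z.map Complex.im⁆ := by
  ext i j
  simp [Ring.lie_def, Matrix.mul_apply]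

theorem complexification_mono (hcg : c ≤ g) : complexification c ≤ complexification g :=
  fun _ hZ => ⟨hcg hZ.1, hcg hZ.2⟩

/-- The comparison map from the abstract complexification `ℂ ⊗ g` to the concrete one. -/
noncomputable def complexificationHom (g : LieSubalgebra ℝ (MatR n)) :
    ℂ ⊗[ℝ] g →ₗ[ℂ] complexification g :=
  TensorProduct.AlgebraTensorModule.lift
    { toFun := fun z =>
        { toFun := fun x => z • ⟨(x : MatR n).map Complex.ofReal, map_ofReal_mem x.2⟩
          map_add' := fun x y => by
            rw [← smul_add]; congr 1; apply Subtype.ext; ext i j; simp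
          map_smul' := fun r x => by
            rw [RingHom.id_apply, smul_comm]; congr 1; apply Subtype.ext; ext i j; simp }
      map_add' := fun z w => by ext x : 1; exact add_smul _ _ _
      map_smul' := fun z w => by ext x : 1; exact mul_smul _ _ _ }

theorem complexificationHom_tmul (z : ℂ) (x : g) :
    complexificationHom g (z ⊗ₜ x) = z • ⟨(x : MatR n).map Complex.ofReal, map_ofReal_mem x.2⟩ :=
  rfl

theorem complexificationHom_lie (u v : ℂ ⊗[ℝ] g) :
    complexificationHom g ⁅u, v⁆ = ⁅complexificationHom g u, complexificationHom g v⁆ := by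
  induction u using TensorProduct.induction_on with
  | zero => simp
  | add a b ha hb => simp only [add_lie, map_add, ha, hb]
  | tmul z x =>
    induction v using TensorProduct.induction_on with
    | zero =>
      have h0 := LieRing.lie_add (z ⊗ₜ[ℝ] x) 0 0
      rw [add_zero, left_eq_add] at h0
      rw [h0, map_zero, lie_zero]
    | add a b ha hb => rw [LieRing.lie_add, map_add, map_add, lie_add, ha, hb]
    | tmul w y =>
      rw [LieAlgebra.ExtendScalars.bracket_tmul, complexificationHom_tmul,
        complexificationHom_tmul, complexificationHom_tmul, smul_lie, lie_smul, smul_smul]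
      congr 1
      exact Subtype.ext (map_ofReal_lie _ _)

theorem complexificationHom_bijective : Function.Bijective (complexificationHom g) := by
  constructor
  -- The inverse splits a matrix into real and imaginary parts; additivity suffices to check it on
  -- pure tensors.
  · let r : complexification g →+ ℂ ⊗[ℝ] g :=
      { toFun := fun Z => 1 ⊗ₜ ⟨(Z : MatC n).map Complex.re, Z.2.1⟩
          + Complex.I ⊗ₜ ⟨(Z : MatC n).map Complex.im, Z.2.2⟩
        map_zero' := by
          have e1 : (⟨((0 : complexification g) : MatC n).map Complex.re,
              (0 : complexification g).2.1⟩ : g) = 0 := by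
            apply Subtype.ext; ext i j; simp
          have e2 : (⟨((0 : complexification g) : MatC n).map Complex.im,
              (0 : complexification g).2.2⟩ : g) = 0 := by
            apply Subtype.ext; ext i j; simp
          rw [e1, e2]; simp
        map_add' := fun Z W => by
          have e1 : (⟨((Z + W : complexification g) : MatC n).map Complex.re, (Z + W).2.1⟩ : g)
              = ⟨(Z : MatC n).map Complex.re, Z.2.1⟩ + ⟨(W : MatC n).map Complex.re, W.2.1⟩ := by
            apply Subtype.ext; ext i j; simp
          have e2 : (⟨((Z + W : complexification g) : MatC n).map Complex.im, (Z + W).2.2⟩ : g)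
              = ⟨(Z : MatC n).map Complex.im, Z.2.2⟩ + ⟨(W : MatC n).map Complex.im, W.2.2⟩ := by
            apply Subtype.ext; ext i j; simp
          rw [e1, e2, TensorProduct.tmul_add, TensorProduct.tmul_add]; abel }
    refine Function.LeftInverse.injective (g := r) fun u => ?_
    induction u using TensorProduct.induction_on with
    | zero => simp
    | add a b ha hb => rw [map_add, map_add, ha, hb]
    | tmul z x =>
      have e1 : (⟨((complexificationHom g (z ⊗ₜ x) : complexification g) : MatC n).map Complex.re,
          (complexificationHom g (z ⊗ₜ x)).2.1⟩ : g) = z.re • x := by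
        apply Subtype.ext; ext i j; simp [complexificationHom_tmul]
      have e2 : (⟨((complexificationHom g (z ⊗ₜ x) : complexification g) : MatC n).map Complex.im,
          (complexificationHom g (z ⊗ₜ x)).2.2⟩ : g) = z.im • x := by
        apply Subtype.ext; ext i j; simp [complexificationHom_tmul]
      change 1 ⊗ₜ[ℝ] _ + Complex.I ⊗ₜ[ℝ] _ = _
      rw [e1, e2, ← TensorProduct.smul_tmul, ← TensorProduct.smul_tmul, ← TensorProduct.add_tmul]
      congr 1
      apply Complex.ext <;> simp
  · intro Z
    refine ⟨1 ⊗ₜ ⟨(Z : MatC n).map Complex.re, Z.2.1⟩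
          + Complex.I ⊗ₜ ⟨(Z : MatC n).map Complex.im, Z.2.2⟩, ?_⟩
    rw [map_add, complexificationHom_tmul, complexificationHom_tmul, one_smul]
    exact Subtype.ext (map_re_add_map_im _)

/-- The concrete complexification is isomorphic to the abstract one. -/
noncomputable def complexificationEquiv (g : LieSubalgebra ℝ (MatR n)) :
    (ℂ ⊗[ℝ] g) ≃ₗ⁅ℂ⁆ complexification g :=
  { LinearEquiv.ofBijective (complexificationHom g) complexificationHom_bijective with
    map_lie' := complexificationHom_lie _ _ }

/-- In a basis that comes from `K`, the Gram matrix of the Killing form is the image of the original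
one, and a nonzero determinant stays nonzero under a map of fields. -/
theorem isKilling_baseChange {K A L : Type*} [Field K] [Field A] [Algebra K A] [LieRing L]
    [LieAlgebra K L] [FiniteDimensional K L] [LieAlgebra.IsKilling K L] :
    LieAlgebra.IsKilling A (A ⊗[K] L) := by
  classical
  have h1 := LieAlgebra.IsKilling.killingForm_nondegenerate K L
  let b := Module.finBasis K L
  have h2 := (LinearMap.BilinForm.nondegenerate_iff_det_ne_zero b).1 h1
  have h3 : killingForm A (A ⊗[K] L) = LinearMap.BilinForm.baseChange A (killingForm K L) :=
    LieModule.traceForm_baseChange K L L A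
  have h4 : (killingForm A (A ⊗[K] L)).Nondegenerate := by
    rw [LinearMap.BilinForm.nondegenerate_iff_det_ne_zero (b.baseChange A)]
    have : LinearMap.BilinForm.toMatrix (b.baseChange A) (killingForm A (A ⊗[K] L))
        = (algebraMap K A).mapMatrix (LinearMap.BilinForm.toMatrix b (killingForm K L)) := by
      ext i j
      rw [h3, RingHom.mapMatrix_apply, Matrix.map_apply, LinearMap.BilinForm.toMatrix_apply,
        LinearMap.BilinForm.toMatrix_apply, Module.Basis.baseChange_apply,
        Module.Basis.baseChange_apply, LinearMap.BilinForm.baseChange_tmul]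
      simp [Algebra.algebraMap_eq_smul_one]
    rw [this, ← RingHom.map_det]
    simpa using h2
  refine ⟨?_⟩
  rw [← LieSubmodule.toSubmodule_eq_bot]
  refine (LieIdeal.coe_killingCompl_top A (A ⊗[K] L)).trans ?_
  exact LinearMap.separatingLeft_iff_ker_eq_bot.1 h4.1

theorem isKilling_complexification [LieAlgebra.IsSemisimple ℝ g] :
    LieAlgebra.IsKilling ℂ (complexification g) := by
  have : LieAlgebra.IsKilling ℂ (ℂ ⊗[ℝ] g) := isKilling_baseChange
  exact LieAlgebra.isKilling_of_equiv (complexificationEquiv g)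

theorem lie_map_ofReal_eq_zero (hc : IsCartan g c) {x y : MatR n} (hx : x ∈ c) (hy : y ∈ c) :
    ⁅x, y⁆ = 0 := by
  have := hc.maximal.1.2
  have := LieModule.IsTrivial.trivial (⟨x, hx⟩ : c) (⟨y, hy⟩ : c)
  exact congrArg Subtype.val this

theorem cartan_lie_eq_zero (hc : IsCartan g c) {x : MatR n} {Z : MatC n} (hx : x ∈ c)
    (hZ : Z ∈ complexification c) : ⁅x.map Complex.ofReal, Z⁆ = 0 := by
  rw [← map_re_add_map_im Z, lie_add, lie_smul, ← map_ofReal_lie, ← map_ofReal_lie,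
    lie_map_ofReal_eq_zero hc hx hZ.1, lie_map_ofReal_eq_zero hc hx hZ.2]
  ext i j; simp

theorem complexification_lie_eq_zero (hc : IsCartan g c) {Z W : MatC n}
    (hZ : Z ∈ complexification c) (hW : W ∈ complexification c) : ⁅Z, W⁆ = 0 := by
  rw [← map_re_add_map_im Z, add_lie, smul_lie, cartan_lie_eq_zero hc hZ.1 hW,
    cartan_lie_eq_zero hc hZ.2 hW, smul_zero, add_zero]

/-- The span of `c` and `x` is an abelian subalgebra of `g`, so maximality puts it inside `c`. -/
theorem mem_cartan_of_commute (hc : IsCartan g c) {x : MatR n} (hx : x ∈ g)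
    (hcomm : ∀ h ∈ c, ⁅h, x⁆ = 0) : x ∈ c := by
  have hz : ∀ y ∈ c.toSubmodule ⊔ ℝ ∙ x, ∀ z ∈ c.toSubmodule ⊔ ℝ ∙ x, ⁅y, z⁆ = 0 := by
    intro y hy z hz
    obtain ⟨h, hh, _, hy', rfl⟩ := Submodule.mem_sup.1 hy
    obtain ⟨r, rfl⟩ := Submodule.mem_span_singleton.1 hy'
    obtain ⟨k, hk, _, hz', rfl⟩ := Submodule.mem_sup.1 hz
    obtain ⟨s, rfl⟩ := Submodule.mem_span_singleton.1 hz'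
    have e1 : ⁅x, k⁆ = 0 := by rw [← lie_skew, hcomm k hk, neg_zero]
    simp only [add_lie, lie_add, smul_lie, lie_smul, e1, hcomm h hh, lie_self,
      lie_map_ofReal_eq_zero hc hh hk, smul_zero, add_zero]
  let a : LieSubalgebra ℝ (MatR n) :=
    { c.toSubmodule ⊔ ℝ ∙ x with
      lie_mem' := fun {y z} hy hz' => by
        rw [hz y hy z hz']; exact Submodule.zero_mem _ }
  have ha : a ≤ g ∧ IsLieAbelian a := by
    refine ⟨?_, ⟨fun y z => Subtype.ext (hz y y.2 z z.2)⟩⟩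
    have : c.toSubmodule ⊔ ℝ ∙ x ≤ g.toSubmodule :=
      sup_le hc.maximal.1.1 ((Submodule.span_singleton_le_iff_mem _ _).2 hx)
    exact this
  have hle : c ≤ a := fun y hy => Submodule.mem_sup_left hy
  exact hc.maximal.2 ha hle (Submodule.mem_sup_right (Submodule.mem_span_singleton_self x))

/-- The complexification of a Cartan subalgebra is its own centralizer. -/
theorem mem_complexification_of_commute (hc : IsCartan g c) {Z : MatC n}
    (hZ : Z ∈ complexification g) (hcomm : ∀ h ∈ c, ⁅h.map Complex.ofReal, Z⁆ = 0) :
    Z ∈ complexification c := by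
  -- Bracketing with a real matrix acts separately on real and imaginary parts, so both commute with
  -- `c`.
  refine ⟨mem_cartan_of_commute hc hZ.1 fun h hh => ?_,
    mem_cartan_of_commute hc hZ.2 fun h hh => ?_⟩
  · rw [← re_lie_map_ofReal, hcomm h hh]; ext i j; simp
  · rw [← im_lie_map_ofReal, hcomm h hh]; ext i j; simp

/-- In a basis of eigenvectors with eigenvalues z_i, the hypothesis says z_i² x_i = 0, hence z_i x_i
= 0. This is how diagonalizability of ad h is used. -/
theorem apply_eq_zero_of_span_eigenvectors {K M : Type*} [Field K] [AddCommGroup M] [Module K M]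
    (T : M →ₗ[K] M) (hT : ⊤ ≤ Submodule.span K {v : M | ∃ z : K, T v = z • v}) {x : M}
    (hx : T (T x) = 0) : T x = 0 := by
  let b := Module.Basis.ofSpan hT
  have hb : ∀ i, ∃ z : K, T (b i) = z • b i := fun i => Module.Basis.ofSpan_subset hT ⟨i, rfl⟩
  choose z hz using hb
  have key : ∀ y i, b.repr (T y) i = z i * b.repr y i := by
    intro y i
    have : (b.coord i) ∘ₗ T = z i • b.coord i := by
      refine b.ext fun j => ?_
      simp only [LinearMap.comp_apply, hz, map_smul, LinearMap.smul_apply, smul_eq_mul,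
        Module.Basis.coord_apply, Module.Basis.repr_self]
      by_cases h : j = i
      · rw [h]
      · simp [Finsupp.single_eq_of_ne' h]
    simpa using LinearMap.congr_fun this y
  apply b.repr.injective
  ext i
  have h1 := key (T x) i
  rw [hx, key, map_zero] at h1
  rw [key, map_zero]
  simpa using h1

theorem lie_eq_zero_of_lie_lie_eq_zero (hc : IsCartan g c) {h : MatR n} (hh : h ∈ c) {Z : MatC n}
    (hZ : Z ∈ complexification g)
    (h0 : ⁅h.map Complex.ofReal, ⁅h.map Complex.ofReal, Z⁆⁆ = 0) :
    ⁅h.map Complex.ofReal, Z⁆ = 0 := by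
  let h' : complexification g := ⟨h.map Complex.ofReal, map_ofReal_mem (hc.maximal.1.1 hh)⟩
  have := apply_eq_zero_of_span_eigenvectors (LieAlgebra.ad ℂ (complexification g) h') (x := ⟨Z, hZ⟩)
    ?_ (Subtype.ext h0)
  · exact congrArg Subtype.val this
  -- The eigenvectors are given as matrices; their span is pulled back to the complexification of
  -- `g`, on which `ad` acts.
  have h1 := Submodule.span_preimage_eq (f := (complexification g).toSubmodule.subtype)
    (s := {v : MatC n | v ∈ complexification g ∧
      ∀ h ∈ c, ∃ z : ℂ, ⁅h.map Complex.ofReal, v⁆ = z • v})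
    ⟨0, (complexification g).zero_mem, fun h _ => ⟨0, by simp⟩⟩ (fun v hv => ⟨⟨v, hv.1⟩, rfl⟩)
  have h2 : (Submodule.span ℂ _).comap (complexification g).toSubmodule.subtype = ⊤ :=
    top_unique fun v _ => hc.diagonalizable v.2
  rw [h2] at h1
  rw [← h1]
  refine Submodule.span_mono ?_
  rintro v ⟨_, hv⟩
  obtain ⟨z, hz⟩ := hv h hh
  exact ⟨z, Subtype.ext hz⟩

end Complexification

end RealSemisimple

namespace RealSemisimple

/-! ### Roots and coroots through the theory of Killing Lie algebras -/

section Roots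

variable {n : ℕ} {g c : LieSubalgebra ℝ (MatR n)}

/-- The complexification of `c` as a subalgebra of the complexification of `g`. -/
def cartanSubalgebra (g c : LieSubalgebra ℝ (MatR n)) : LieSubalgebra ℂ (complexification g) :=
  (complexification c).comap (complexification g).incl

/-- If `x` normalizes 𝔠^ℂ, then [h, x] lies in 𝔠^ℂ and [h, [h, x]] = 0 for `h` in `c`.
Diagonalizability gives [h, x] = 0, so `x` lies in the centralizer, which is 𝔠^ℂ. -/
theorem isCartanSubalgebra (hc : IsCartan g c) : (cartanSubalgebra g c).IsCartanSubalgebra where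
  nilpotent := by
    have : IsLieAbelian (cartanSubalgebra g c) :=
      ⟨fun x y => Subtype.ext (Subtype.ext (complexification_lie_eq_zero hc x.2 y.2))⟩
    infer_instance
  self_normalizing := by
    refine le_antisymm (fun x hx => ?_) (LieSubalgebra.le_normalizer _)
    rw [LieSubalgebra.mem_normalizer_iff'] at hx
    refine mem_complexification_of_commute hc x.2 fun h hh => ?_
    have hhg : h.map Complex.ofReal ∈ complexification g := map_ofReal_mem (hc.maximal.1.1 hh)
    have h1 := hx ⟨h.map Complex.ofReal, hhg⟩ (map_ofReal_mem hh)
    exact lie_eq_zero_of_lie_lie_eq_zero hc hh x.2 (cartan_lie_eq_zero hc hh h1)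

/-- The identification of `cartanSubalgebra g c` with the complexification of `c`. -/
def cartanEquiv (hcg : c ≤ g) : cartanSubalgebra g c ≃ₗ[ℂ] complexification c where
  toFun h := ⟨h.1.1, h.2⟩
  invFun h := ⟨⟨h.1, complexification_mono hcg h.2⟩, h.2⟩
  map_add' _ _ := rfl
  map_smul' _ _ := rfl
  left_inv _ := rfl
  right_inv _ := rfl

theorem IsStandardPair.apply_lie {α : CDual c} {X Y : MatC n} (h : IsStandardPair g c α X Y)
    {H : complexification c} (hH : (H : MatC n) = ⁅X, Y⁆) : α H = 2 := by
  have h1 := h.mem_pos.2 H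
  rw [hH, h.triple.lie_h_e_smul ℂ] at h1
  exact (smul_left_injective ℂ h.triple.e_ne_zero h1).symm

/-- By the Jacobi identity the weights `α` and `-α` cancel, so the bracket centralizes `c`. -/
theorem lie_mem_cartan (hc : IsCartan g c) {α : CDual c} {X Y : MatC n}
    (hX : X ∈ rootSpace g c α) (hY : Y ∈ rootSpace g c (-α)) : ⁅X, Y⁆ ∈ complexification c := by
  refine mem_complexification_of_commute hc ((complexification g).lie_mem hX.1 hY.1) fun h hh => ?_
  have e1 := hX.2 ⟨_, map_ofReal_mem hh⟩
  have e2 := hY.2 ⟨_, map_ofReal_mem hh⟩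
  rw [leibniz_lie, e1, e2, smul_lie, lie_smul, LinearMap.neg_apply, neg_smul, add_neg_cancel]

variable [(cartanSubalgebra g c).IsCartanSubalgebra]

/-- A weight of `cartanSubalgebra g c`, as a linear function on the complexification of `c`. -/
noncomputable def weightDual (hcg : c ≤ g)
    (w : LieModule.Weight ℂ (cartanSubalgebra g c) (complexification g)) : CDual c :=
  w.toLinear ∘ₗ (cartanEquiv hcg).symm.toLinearMap

theorem weightDual_comp (hcg : c ≤ g)
    (w : LieModule.Weight ℂ (cartanSubalgebra g c) (complexification g)) :
    weightDual hcg w ∘ cartanEquiv hcg = w := by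
  ext x; simp [weightDual]

variable [LieAlgebra.IsKilling ℂ (complexification g)]

/-- The right side is a generalized weight space; in a Killing Lie algebra the Cartan subalgebra
acts on it by honest eigenvalues. -/
theorem mem_rootSpace_iff (hcg : c ≤ g) (α : CDual c) (v : complexification g) :
    (v : MatC n) ∈ rootSpace g c α ↔
      v ∈ LieAlgebra.rootSpace (cartanSubalgebra g c) (α ∘ cartanEquiv hcg) := by
  constructor
  · intro hv
    refine LieModule.weightSpace_le_genWeightSpace _ _ ((LieModule.mem_weightSpace _ _).2 ?_)
    intro x
    exact Subtype.ext (hv.2 (cartanEquiv hcg x))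
  · intro hv
    refine ⟨v.2, fun H => ?_⟩
    exact congrArg Subtype.val
      (LieAlgebra.IsKilling.lie_eq_smul_of_mem_rootSpace hv ((cartanEquiv hcg).symm H))

theorem isRoot_iff (hcg : c ≤ g) (α : CDual c) :
    IsRoot g c α ↔ ∃ w : LieModule.Weight ℂ (cartanSubalgebra g c) (complexification g),
      w.IsNonZero ∧ weightDual hcg w = α := by
  constructor
  · rintro ⟨h0, h1⟩
    obtain ⟨v, hv, hv0⟩ := (Submodule.ne_bot_iff _).1 h1
    have hv' := (mem_rootSpace_iff hcg α ⟨v, hv.1⟩).1 hv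
    let w : LieModule.Weight ℂ (cartanSubalgebra g c) (complexification g) :=
      { toFun := α ∘ cartanEquiv hcg
        genWeightSpace_ne_bot' := fun e => hv0 (by
          rw [LieAlgebra.rootSpace, e] at hv'
          exact congrArg Subtype.val ((LieSubmodule.mem_bot _).1 hv')) }
    refine ⟨w, fun hw => h0 ?_, ?_⟩
    · ext H
      exact congrFun hw ((cartanEquiv hcg).symm H)
    · ext H; rfl
  · rintro ⟨w, hw, rfl⟩
    refine ⟨fun e => hw ?_, ?_⟩
    · rw [LieModule.Weight.IsZero, ← weightDual_comp hcg w, e]; rfl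
    · obtain ⟨v, hv, hv0⟩ := w.exists_ne_zero
      rw [Submodule.ne_bot_iff]
      refine ⟨v, (mem_rootSpace_iff hcg _ v).2 (by rwa [weightDual_comp]), fun e => hv0 ?_⟩
      exact Subtype.ext e

theorem exists_isStandardPair (hcg : c ≤ g) {α : CDual c} (hα : IsRoot g c α) :
    ∃ X Y, IsStandardPair g c α X Y := by
  obtain ⟨w, hw, rfl⟩ := (isRoot_iff hcg _).1 hα
  obtain ⟨h, e, f, ht, he, hf⟩ := LieAlgebra.IsKilling.exists_isSl2Triple_of_weight_isNonZero hw
  refine ⟨e, f, (mem_rootSpace_iff hcg _ e).2 (by rwa [weightDual_comp]),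
    (mem_rootSpace_iff hcg _ f).2 ?_, ?_⟩
  · rw [LinearMap.coe_neg, Pi.neg_comp, weightDual_comp]; exact hf
  · refine ⟨fun e0 => ht.h_ne_zero ?_, rfl, ?_, ?_⟩
    · rw [← ht.lie_e_f]; exact Subtype.ext e0
    · have := congrArg Subtype.val ht.lie_h_e_nsmul
      rw [← ht.lie_e_f] at this; exact this
    · have := congrArg Subtype.val ht.lie_h_f_nsmul
      rw [← ht.lie_e_f] at this; exact this

/-- The value 2 singles out one element of the coroot space, so the coroot defined by choice agrees
with the one of the general theory. -/
theorem eq_coroot_aux (hcg : c ≤ g)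
    (w : LieModule.Weight ℂ (cartanSubalgebra g c) (complexification g)) {H : complexification c}
    (h1 : ∃ x ∈ rootSpace g c (weightDual hcg w), ∃ y ∈ rootSpace g c (-weightDual hcg w),
      (H : MatC n) = ⁅x, y⁆) (h2 : weightDual hcg w H = 2) :
    H = cartanEquiv hcg (LieAlgebra.IsKilling.coroot w) := by
  rw [← LinearEquiv.symm_apply_eq]
  obtain ⟨x, hx, y, hy, e⟩ := h1
  refine LieAlgebra.IsKilling.eq_coroot_of_mem_corootSpace_of_two w ?_ h2
  rw [LieAlgebra.mem_corootSpace]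
  refine Submodule.subset_span ⟨⟨x, hx.1⟩, ?_, ⟨y, hy.1⟩, ?_, Subtype.ext e.symm⟩
  · have := (mem_rootSpace_iff hcg _ ⟨x, hx.1⟩).1 hx
    rwa [weightDual_comp] at this
  · have := (mem_rootSpace_iff hcg _ ⟨y, hy.1⟩).1 hy
    have e' : ⇑(-weightDual hcg w) ∘ cartanEquiv hcg = -⇑w := by
      rw [LinearMap.coe_neg, Pi.neg_comp, weightDual_comp]
    exact e' ▸ this

/-- The choice defining `coroot` is meaningful because an 𝔰𝔩₂-triple supplies a witness. -/
theorem coroot_spec (hc : IsCartan g c) {α : CDual c} (hα : IsRoot g c α) :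
    (∃ x ∈ rootSpace g c α, ∃ y ∈ rootSpace g c (-α), (coroot g α : MatC n) = ⁅x, y⁆) ∧
      α (coroot g α) = 2 := by
  obtain ⟨X, Y, h⟩ := exists_isStandardPair hc.maximal.1.1 hα
  exact Classical.epsilon_spec (p := fun H : complexification c =>
    (∃ x ∈ rootSpace g c α, ∃ y ∈ rootSpace g c (-α), (H : MatC n) = ⁅x, y⁆) ∧ α H = 2)
    ⟨⟨⁅X, Y⁆, lie_mem_cartan hc h.mem_pos h.mem_neg⟩, ⟨X, h.mem_pos, Y, h.mem_neg, rfl⟩,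
      h.apply_lie rfl⟩

theorem coroot_weightDual (hc : IsCartan g c)
    {w : LieModule.Weight ℂ (cartanSubalgebra g c) (complexification g)} (hw : w.IsNonZero) :
    coroot g (weightDual hc.maximal.1.1 w)
      = cartanEquiv hc.maximal.1.1 (LieAlgebra.IsKilling.coroot w) := by
  have h := coroot_spec hc ((isRoot_iff hc.maximal.1.1 _).2 ⟨w, hw, rfl⟩)
  exact eq_coroot_aux _ w h.1 h.2

theorem IsStandardPair.lie_eq_coroot (hc : IsCartan g c) {α : CDual c} (hα : IsRoot g c α)
    {X Y : MatC n} (h : IsStandardPair g c α X Y) : (coroot g α : MatC n) = ⁅X, Y⁆ := by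
  obtain ⟨w, hw, rfl⟩ := (isRoot_iff hc.maximal.1.1 _).1 hα
  rw [coroot_weightDual hc hw, ← eq_coroot_aux hc.maximal.1.1 w
    (H := ⟨⁅X, Y⁆, lie_mem_cartan hc h.mem_pos h.mem_neg⟩)
    ⟨X, h.mem_pos, Y, h.mem_neg, rfl⟩ (h.apply_lie rfl)]

theorem weightDual_coroot (hc : IsCartan g c)
    (v : LieModule.Weight ℂ (cartanSubalgebra g c) (complexification g))
    {w : LieModule.Weight ℂ (cartanSubalgebra g c) (complexification g)} (hw : w.IsNonZero) :
    weightDual hc.maximal.1.1 v (coroot g (weightDual hc.maximal.1.1 w))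
      = v (LieAlgebra.IsKilling.coroot w) := by
  rw [coroot_weightDual hc hw]
  simp [weightDual]

/-- The roots of a Cartan subalgebra form a finite reduced crystallographic set of roots. -/
theorem isRootSet (hc : IsCartan g c) :
    IsRootSet {α : CDual c | IsRoot g c α} (fun α => Module.Dual.eval ℂ _ (coroot g α)) where
  finite := by
    refine (Set.finite_range (weightDual (g := g) hc.maximal.1.1)).subset fun α hα => ?_
    obtain ⟨w, -, h⟩ := (isRoot_iff hc.maximal.1.1 α).1 hα
    exact ⟨w, h⟩
  zero_notMem h := h.1 rfl
  neg_mem α hα := by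
    obtain ⟨w, hw, rfl⟩ := (isRoot_iff hc.maximal.1.1 α).1 hα
    exact (isRoot_iff hc.maximal.1.1 _).2 ⟨-w, hw.neg, rfl⟩
  self α hα := (coroot_spec hc hα).2
  int α hα β hβ := by
    obtain ⟨v, hv, rfl⟩ := (isRoot_iff hc.maximal.1.1 α).1 hα
    obtain ⟨w, hw, rfl⟩ := (isRoot_iff hc.maximal.1.1 β).1 hβ
    rw [Module.Dual.eval_apply, weightDual_coroot hc w hv]
    exact ⟨_, LieAlgebra.IsKilling.apply_coroot_eq_cast v w⟩
  reflection_mem α hα β hβ := by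
    obtain ⟨v, hv, rfl⟩ := (isRoot_iff hc.maximal.1.1 α).1 hα
    obtain ⟨w, hw, rfl⟩ := (isRoot_iff hc.maximal.1.1 β).1 hβ
    rw [Module.Dual.eval_apply, weightDual_coroot hc w hv]
    exact (isRoot_iff hc.maximal.1.1 _).2 ⟨LieAlgebra.IsKilling.reflectRoot v w,
      LieAlgebra.IsKilling.reflectRoot_isNonZero v w hw, rfl⟩
  sub_mem α hα β hβ k hk hk0 hne := by
    obtain ⟨v, hv, rfl⟩ := (isRoot_iff hc.maximal.1.1 α).1 hα
    obtain ⟨w, hw, rfl⟩ := (isRoot_iff hc.maximal.1.1 β).1 hβ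
    rw [Module.Dual.eval_apply, weightDual_coroot hc w hv] at hk
    let S := LieAlgebra.IsKilling.rootSystem (cartanSubalgebra g c)
    let i : (cartanSubalgebra g c).root := ⟨w, by simpa using hw⟩
    let j : (cartanSubalgebra g c).root := ⟨v, by simpa using hv⟩
    -- The root comes first and the coroot second: `i` stands for `β` and `j` for `α`.
    have hp : S.pairingIn ℤ i j = k := by
      have h1 := S.algebraMap_pairingIn ℤ i j
      rw [LieAlgebra.IsKilling.rootSystem_pairing_apply, hk] at h1
      simpa using h1
    obtain ⟨⟨u, hu⟩, hu'⟩ := S.root_sub_root_mem_of_pairingIn_pos (i := i) (j := j) (hp ▸ hk0)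
      (fun e => hne (congrArg (weightDual hc.maximal.1.1) (congrArg Subtype.val e)))
    refine (isRoot_iff hc.maximal.1.1 _).2 ⟨u, by simpa using hu, ?_⟩
    ext H
    exact LinearMap.congr_fun hu' ((cartanEquiv hc.maximal.1.1).symm H)
  two_nsmul_notMem α hα h2 := by
    obtain ⟨v, hv, rfl⟩ := (isRoot_iff hc.maximal.1.1 α).1 hα
    obtain ⟨w, hw, hw'⟩ := (isRoot_iff hc.maximal.1.1 _).1 h2
    refine w.genWeightSpace_ne_bot' ?_
    change LieModule.genWeightSpace (complexification g) ⇑w = ⊥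
    rw [← weightDual_comp hc.maximal.1.1 w, hw', ← two_nsmul, LinearMap.coe_smul, Pi.smul_comp,
      weightDual_comp]
    exact LieAlgebra.IsKilling.rootSpace_two_smul v hv

end Roots

end RealSemisimple

namespace RealSemisimple

/-! ### Conjugation by exponentials -/

section Exp

open scoped Nat

theorem hasSum_exp_apply {E : Type*} [NormedAddCommGroup E] [NormedSpace ℂ E] [CompleteSpace E]
    (T : E →L[ℂ] E) (z : E) :
    HasSum (fun k : ℕ => ((k ! : ℂ)⁻¹) • (T ^ k) z) (NormedSpace.exp T z) :=
  (NormedSpace.exp_series_hasSum_exp' (𝕂 := ℂ) T).mapL (ContinuousLinearMap.apply ℂ E z)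

section Banach

variable {A : Type*} [NormedRing A] [NormedAlgebra ℂ A]

/-- The commutator with `x` as a continuous linear map. -/
noncomputable def adL (x : A) : A →L[ℂ] A :=
  ContinuousLinearMap.mul ℂ A x + (ContinuousLinearMap.mul ℂ A).flip (-x)

theorem adL_apply (x z : A) : adL x z = x * z - z * x := by
  simp [adL, sub_eq_add_neg]

variable [CompleteSpace A]

theorem exp_mul_apply (x z : A) :
    NormedSpace.exp (ContinuousLinearMap.mul ℂ A x) z = NormedSpace.exp x * z := by
  have hp : ∀ k : ℕ, ((ContinuousLinearMap.mul ℂ A x) ^ k) z = x ^ k * z := by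
    intro k
    induction k with
    | zero => simp
    | succ k ih =>
      rw [pow_succ', mul_apply_eq_comp, ih, pow_succ', mul_assoc]
      rfl
  refine (hasSum_exp_apply _ z).unique ?_
  simp_rw [hp, ← smul_mul_assoc]
  exact (NormedSpace.exp_series_hasSum_exp' (𝕂 := ℂ) x).mul_right z

theorem exp_mul_flip_apply (x z : A) :
    NormedSpace.exp ((ContinuousLinearMap.mul ℂ A).flip x) z = z * NormedSpace.exp x := by
  have hp : ∀ k : ℕ, (((ContinuousLinearMap.mul ℂ A).flip x) ^ k) z = z * x ^ k := by
    intro k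
    induction k with
    | zero => simp
    | succ k ih =>
      rw [pow_succ', mul_apply_eq_comp, ih, pow_succ, ← mul_assoc]
      rfl
  refine (hasSum_exp_apply _ z).unique ?_
  simp_rw [hp, ← mul_smul_comm]
  exact (NormedSpace.exp_series_hasSum_exp' (𝕂 := ℂ) x).mul_left z

/-- ad x is the sum of left multiplication by `x` and right multiplication by `-x`. These commute,
so the exponential factors. -/
theorem exp_adL_apply (x z : A) :
    NormedSpace.exp (adL x) z = NormedSpace.exp x * z * NormedSpace.exp (-x) := by
  let : NormedAlgebra ℚ (A →L[ℂ] A) := NormedAlgebra.restrictScalars ℚ ℂ _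
  have hcomm : Commute (ContinuousLinearMap.mul ℂ A x)
      ((ContinuousLinearMap.mul ℂ A).flip (-x)) := by
    ext z
    simp [mul_assoc]
  rw [adL, NormedSpace.exp_add_of_commute hcomm, mul_apply_eq_comp,
    exp_mul_flip_apply, exp_mul_apply, mul_assoc]

theorem exp_conj_eq (x z : A) (h : adL x (adL x (adL x z)) = 0) :
    NormedSpace.exp x * z * NormedSpace.exp (-x)
      = z + adL x z + (2⁻¹ : ℂ) • adL x (adL x z) := by
  rw [← exp_adL_apply]
  have h0 : ∀ k ∉ Finset.range 3, ((k ! : ℂ)⁻¹) • (adL x ^ k) z = 0 := by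
    intro k hk
    obtain ⟨m, rfl⟩ := Nat.exists_eq_add_of_le (not_lt.1 fun h => hk (Finset.mem_range.2 h))
    rw [add_comm 3 m, pow_add, mul_apply_eq_comp,
      show (adL x ^ 3) z = 0 from h, map_zero, smul_zero]
  rw [(hasSum_exp_apply (adL x) z).unique (hasSum_sum_of_ne_finset_zero h0)]
  simp [Finset.sum_range_succ]

/-- All partial sums of the series of exp(ad x) applied to `z` stay in `S`, and `S` is closed. -/
theorem exp_conj_mem (S : Submodule ℂ A) (hS : IsClosed (S : Set A)) (x : A)
    (hx : ∀ z ∈ S, x * z - z * x ∈ S) {z : A} (hz : z ∈ S) :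
    NormedSpace.exp x * z * NormedSpace.exp (-x) ∈ S := by
  rw [← exp_adL_apply]
  have hp : ∀ k : ℕ, (adL x ^ k) z ∈ S := by
    intro k
    induction k with
    | zero => simpa
    | succ k ih =>
      rw [pow_succ', mul_apply_eq_comp, adL_apply]
      exact hx _ ih
  exact hS.mem_of_tendsto (hasSum_exp_apply (adL x) z)
    (Filter.Eventually.of_forall fun s => S.sum_mem fun k _ => S.smul_mem _ (hp k))

end Banach

variable {n : ℕ}

/-- Conjugation by an invertible matrix, as a linear map. -/
def conjL (k : GL (Fin n) ℂ) : MatC n →ₗ[ℂ] MatC n where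
  toFun Z := (k : MatC n) * Z * ((k⁻¹ : GL (Fin n) ℂ) : MatC n)
  map_add' Z W := by rw [mul_add, add_mul]
  map_smul' z Z := by simp

theorem conjL_apply (k : GL (Fin n) ℂ) (Z : MatC n) :
    conjL k Z = (k : MatC n) * Z * ((k⁻¹ : GL (Fin n) ℂ) : MatC n) := rfl

theorem conjL_mul (k k' : GL (Fin n) ℂ) (Z : MatC n) :
    conjL (k * k') Z = conjL k (conjL k' Z) := by
  simp [conjL_apply, mul_assoc]

theorem conjL_inv_conjL (k : GL (Fin n) ℂ) (Z : MatC n) : conjL k⁻¹ (conjL k Z) = Z := by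
  rw [← conjL_mul, inv_mul_cancel]; simp [conjL_apply]

theorem conjL_conjL_inv (k : GL (Fin n) ℂ) (Z : MatC n) : conjL k (conjL k⁻¹ Z) = Z := by
  rw [← conjL_mul, mul_inv_cancel]; simp [conjL_apply]

theorem conjL_lie (k : GL (Fin n) ℂ) (Z W : MatC n) :
    conjL k ⁅Z, W⁆ = ⁅conjL k Z, conjL k W⁆ := by
  simp only [Ring.lie_def, map_sub]
  simp [conjL_apply, mul_assoc]

theorem conjL_expGL (X Z : MatC n) :
    conjL (expGL X) Z = NormedSpace.exp X * Z * NormedSpace.exp (-X) := by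
  rw [conjL_apply, Matrix.coe_units_inv, Matrix.exp_neg]
  rfl

theorem conjL_expGL_eq {X Z A B : MatC n} (hA : ⁅X, Z⁆ = A) (hB : ⁅X, A⁆ = B)
    (h0 : ⁅X, B⁆ = 0) : conjL (expGL X) Z = Z + A + (2⁻¹ : ℂ) • B := by
  -- An auxiliary norm, needed only to apply the Banach algebra results.
  let : NormedRing (MatC n) := Matrix.linftyOpNormedRing
  let : NormedAlgebra ℂ (MatC n) := Matrix.linftyOpNormedAlgebra
  rw [Ring.lie_def] at hA hB h0
  rw [conjL_expGL]
  have := exp_conj_eq X Z (by rw [adL_apply X Z, hA, adL_apply X A, hB, adL_apply X B, h0])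
  rwa [adL_apply X Z, hA, adL_apply X A, hB] at this

theorem conjL_expGL_mem (S : LieSubalgebra ℂ (MatC n)) {X Z : MatC n} (hX : X ∈ S) (hZ : Z ∈ S) :
    conjL (expGL X) Z ∈ S := by
  let : NormedRing (MatC n) := Matrix.linftyOpNormedRing
  let : NormedAlgebra ℂ (MatC n) := Matrix.linftyOpNormedAlgebra
  rw [conjL_expGL]
  exact exp_conj_mem S.toSubmodule S.toSubmodule.closed_of_finiteDimensional X
    (fun W hW => S.lie_mem hX hW) hZ

theorem conjL_mem_of_mem_complexGroup {g : LieSubalgebra ℝ (MatR n)} {k : GL (Fin n) ℂ}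
    (hk : k ∈ complexGroup g) {Z : MatC n} (hZ : Z ∈ complexification g) :
    conjL k Z ∈ complexification g := by
  induction hk using Subgroup.closure_induction'' generalizing Z with
  | one => simpa [conjL_apply] using hZ
  | mem k hk =>
    obtain ⟨X, hX, rfl⟩ := hk
    exact conjL_expGL_mem _ hX hZ
  | inv_mem k hk =>
    obtain ⟨X, hX, rfl⟩ := hk
    have : (expGL X)⁻¹ = expGL (-X) := by
      ext1
      rw [Matrix.coe_units_inv]
      exact (Matrix.exp_neg X).symm
    rw [this]
    exact conjL_expGL_mem _ (neg_mem (show X ∈ complexification g from hX)) hZ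
  | mul k k' _ _ h h' =>
    rw [conjL_mul]
    exact h (h' hZ)

/-- Conjugation by `exp(X) exp(-Y) exp(X)` acts on the Cartan subalgebra as a reflection. -/
theorem conjL_weylRep {X Y H : MatC n} (h : IsSl2Triple ⁅X, Y⁆ X Y) {a : ℂ}
    (hX : ⁅H, X⁆ = a • X) (hY : ⁅H, Y⁆ = -(a • Y)) :
    conjL (weylRep X Y) H = H - a • ⁅X, Y⁆ := by
  set T := ⁅X, Y⁆ with hT
  have e1 : ⁅X, H⁆ = -(a • X) := by rw [← lie_skew, hX]
  have e2 : ⁅Y, H⁆ = a • Y := by rw [← lie_skew, hY, neg_neg]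
  have e3 : ⁅Y, X⁆ = -T := by rw [← lie_skew]
  have e4 : ⁅X, T⁆ = -((2 : ℂ) • X) := by rw [← lie_skew, h.lie_h_e_smul ℂ]
  have e5 : ⁅Y, T⁆ = (2 : ℂ) • Y := by
    rw [← lie_skew, h.lie_lie_smul_f ℂ, neg_neg]
  have s1 : conjL (expGL X) H = H - a • X := by
    rw [conjL_expGL_eq e1 (B := 0) (by simp) (by simp)]
    module
  -- The quadratic term contributes `a • Y`, which cancels the `Y` part of the linear term.
  have s2 : conjL (expGL (-Y)) (H - a • X) = H - a • X - a • T := by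
    rw [conjL_expGL_eq (A := -(a • Y) - a • T) (B := (2 * a) • Y)]
    · module
    · rw [neg_lie, lie_sub, lie_smul, e2, e3]
      module
    · rw [neg_lie, lie_sub, lie_neg, lie_smul, lie_smul, lie_self, e5]
      module
    · simp
  have s3 : conjL (expGL X) (H - a • X - a • T) = H - a • T := by
    rw [conjL_expGL_eq (A := a • X) (B := 0)]
    · module
    · rw [lie_sub, lie_sub, lie_smul, lie_smul, lie_self, e1, e4]
      module
    · simp
    · simp
  rw [weylRep, conjL_mul, conjL_mul, s1, s2, s3]

end Exp

end RealSemisimple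

namespace RealSemisimple

/-! ### Group elements representing Weyl words, and complex conjugation of root spaces -/

section Weyl

variable {n : ℕ} {g c : LieSubalgebra ℝ (MatR n)}

/-- `k` is an element of the complex group which normalizes the complexification of `c` and acts
there by the dual of `u`. -/
structure Represents (g : LieSubalgebra ℝ (MatR n)) {c : LieSubalgebra ℝ (MatR n)}
    (k : GL (Fin n) ℂ) (u : CDual c → CDual c) : Prop where
  mem : k ∈ complexGroup g
  exists_inv : ∀ H : complexification c, ∃ K : complexification c,
    (K : MatC n) = conjL k⁻¹ H ∧ ∀ l : CDual c, l K = u l H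
  exists_conj : ∀ K : complexification c, ∃ H : complexification c, (K : MatC n) = conjL k⁻¹ H

theorem Represents.one : Represents g (1 : GL (Fin n) ℂ) (id : CDual c → CDual c) where
  mem := one_mem _
  exists_inv H := ⟨H, by simp [conjL_apply], fun _ => rfl⟩
  exists_conj K := ⟨K, by simp [conjL_apply]⟩

theorem Represents.mul {k k' : GL (Fin n) ℂ} {u u' : CDual c → CDual c}
    (h : Represents g k u) (h' : Represents g k' u') : Represents g (k * k') (u ∘ u') where
  mem := mul_mem h.mem h'.mem
  exists_inv H := by
    obtain ⟨K, hK, hu⟩ := h.exists_inv H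
    obtain ⟨K', hK', hu'⟩ := h'.exists_inv K
    refine ⟨K', ?_, fun l => ?_⟩
    · rw [hK', hK, mul_inv_rev, conjL_mul]
    · rw [hu', hu]; rfl
  exists_conj K := by
    obtain ⟨K', hK'⟩ := h'.exists_conj K
    obtain ⟨H, hH⟩ := h.exists_conj K'
    exact ⟨H, by rw [hK', hH, mul_inv_rev, conjL_mul]⟩

theorem Represents.conjugate_eq {k : GL (Fin n) ℂ} {u : CDual c → CDual c}
    (h : Represents g k u) :
    conjugate k (complexification c) = (complexification c : Set (MatC n)) := by
  ext Z
  constructor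
  · rintro ⟨W, hW, rfl⟩
    obtain ⟨H, hH⟩ := h.exists_conj ⟨W, hW⟩
    have : conjL k W = H := by
      rw [show W = conjL k⁻¹ H from hH, conjL_conjL_inv]
    change conjL k W ∈ complexification c
    rw [this]; exact H.2
  · intro hZ
    obtain ⟨K, hK, -⟩ := h.exists_inv ⟨Z, hZ⟩
    refine ⟨K, K.2, ?_⟩
    rw [hK]
    exact conjL_conjL_inv k Z

/-- Conjugation respects brackets, so [H, k v k⁻¹] = k [k⁻¹ H k, v] k⁻¹, and α(k⁻¹ H k) = (u α)(H).
-/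
theorem Represents.map_rootSpace {k : GL (Fin n) ℂ} {u : CDual c → CDual c}
    (h : Represents g k u) (α : CDual c) :
    (rootSpace g c α).map (conjL k) = rootSpace g c (u α) := by
  ext v
  constructor
  · rintro ⟨v, hv, rfl⟩
    refine ⟨conjL_mem_of_mem_complexGroup h.mem hv.1, fun H => ?_⟩
    obtain ⟨K, hK, hu⟩ := h.exists_inv H
    rw [← conjL_conjL_inv k (H : MatC n), ← conjL_lie, ← hK, hv.2 K, hu, map_smul]
  · intro hv
    refine ⟨conjL k⁻¹ v, ⟨conjL_mem_of_mem_complexGroup (inv_mem h.mem) hv.1, fun K => ?_⟩,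
      conjL_conjL_inv k v⟩
    obtain ⟨H, hH⟩ := h.exists_conj K
    obtain ⟨K', hK', hu⟩ := h.exists_inv H
    have e : K = K' := Subtype.ext (hH.trans hK'.symm)
    rw [hH, ← conjL_lie, hv.2 H, e, hu, map_smul]

theorem weylRep_mem {X Y : MatC n} (hX : X ∈ complexification g) (hY : Y ∈ complexification g) :
    weylRep X Y ∈ complexGroup g :=
  mul_mem (mul_mem (Subgroup.subset_closure ⟨X, hX, rfl⟩)
    (Subgroup.subset_closure ⟨-Y, neg_mem hY, rfl⟩)) (Subgroup.subset_closure ⟨X, hX, rfl⟩)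

/-- Conjugation acts on 𝔠^ℂ by H ↦ H - α(H) H_α. This is an involution, so the inverse acts in the
same way, and its transpose is the reflection in `α`. -/
theorem IsStandardPair.represents {α : CDual c} {X Y : MatC n} (h : IsStandardPair g c α X Y)
    (hco : (coroot g α : MatC n) = ⁅X, Y⁆) : Represents g (weylRep X Y) (reflect g α) := by
  have h2 : α (coroot g α) = 2 := by
    have h1 := h.mem_pos.2 (coroot g α)
    rw [hco, h.triple.lie_h_e_smul ℂ] at h1
    exact (smul_left_injective ℂ h.triple.e_ne_zero h1).symm
  let r : complexification c → complexification c := fun H => H - α H • coroot g α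
  have hr : ∀ H : complexification c, conjL (weylRep X Y) (H : MatC n) = r H := by
    intro H
    rw [conjL_weylRep h.triple (h.mem_pos.2 H), ← hco]
    · rfl
    · rw [h.mem_neg.2 H]; simp
  have hrr : ∀ H, r (r H) = H := by
    intro H
    simp only [r, map_sub, map_smul, h2, smul_eq_mul]
    module
  have hinv : ∀ H : complexification c, (r H : MatC n) = conjL (weylRep X Y)⁻¹ H := by
    intro H
    conv_rhs => rw [← hrr H, ← hr, conjL_inv_conjL]
  refine ⟨weylRep_mem h.mem_pos.1 h.mem_neg.1, fun H => ⟨r H, hinv H, fun l => ?_⟩,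
    fun K => ⟨r K, by rw [← hinv, hrr]⟩⟩
  simp [r, reflect, mul_comm]

theorem represents_omega {X Y : CDual c → MatC n} :
    ∀ β : List (CDual c), (∀ α ∈ β, Represents g (weylRep (X α) (Y α)) (reflect g α)) →
      Represents g (omega X Y β) (weylWord g β)
  | [], _ => Represents.one
  | α :: β, h => by
    have h1 := (h α (by simp)).mul (represents_omega β fun γ hγ => h γ (by simp [hγ]))
    have e : omega X Y (α :: β) = weylRep (X α) (Y α) * omega X Y β := by simp [omega]
    rw [e]; exact h1

/-- Complex conjugation of matrices, as a semilinear map. -/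
def conjMatL : MatC n →ₛₗ[starRingEnd ℂ] MatC n where
  toFun := conjMat
  map_add' Z W := by ext i j; simp [conjMat]
  map_smul' z Z := by ext i j; simp [conjMat]

theorem conjMat_conjMat (Z : MatC n) : conjMat (conjMat Z) = Z := by
  ext i j; simp [conjMat]

theorem conjMat_lie (Z W : MatC n) : conjMat ⁅Z, W⁆ = ⁅conjMat Z, conjMat W⁆ := by
  ext i j
  simp [conjMat, Ring.lie_def, Matrix.mul_apply]

theorem conjDual_apply (l : CDual c) (H : complexification c) :
    conjDual l H = starRingEnd ℂ (l ⟨conjMat (H : MatC n), conjMat_mem H.2⟩) := rfl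

theorem conjDual_conjDual (l : CDual c) : conjDual (conjDual l) = l := by
  ext H
  rw [conjDual_apply, conjDual_apply, starRingEnd_self_apply]
  congr 1
  exact Subtype.ext (conjMat_conjMat _)

/-- Apply σ to the eigenvector equation for σ(H): the bracket becomes [H, σ(v)] and the eigenvalue
is conjugated. -/
theorem conjMat_mem_rootSpace {α : CDual c} {v : MatC n} (hv : v ∈ rootSpace g c α) :
    conjMat v ∈ rootSpace g c (conjDual α) := by
  refine ⟨conjMat_mem hv.1, fun H => ?_⟩
  have h := congrArg conjMat (hv.2 ⟨conjMat (H : MatC n), conjMat_mem H.2⟩)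
  rw [conjMat_lie, conjMat_conjMat] at h
  rw [h]
  exact conjMatL.map_smulₛₗ _ _

theorem map_conjMat_rootSpace (α : CDual c) :
    (rootSpace g c α).map conjMatL = rootSpace g c (conjDual α) := by
  ext v
  constructor
  · rintro ⟨v, hv, rfl⟩
    exact conjMat_mem_rootSpace hv
  · intro hv
    have := conjMat_mem_rootSpace hv
    rw [conjDual_conjDual] at this
    exact ⟨_, this, conjMat_conjMat v⟩

theorem IsRoot.conjDual {α : CDual c} (hα : IsRoot g c α) : IsRoot g c (conjDual α) := by
  refine ⟨fun e => hα.1 ?_, ?_⟩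
  · rw [← conjDual_conjDual α, e]
    ext H; simp [conjDual_apply]
  · obtain ⟨v, hv, hv0⟩ := (Submodule.ne_bot_iff _).1 hα.2
    refine (Submodule.ne_bot_iff _).2 ⟨_, conjMat_mem_rootSpace hv, fun e => hv0 ?_⟩
    rw [← conjMat_conjMat v, e]
    ext i j; simp [conjMat]

/-- `weylWord` followed by `conjDual`, as an additive map. -/
noncomputable def conjWord (g : LieSubalgebra ℝ (MatR n)) (β : List (CDual c)) :
    CDual c →+ CDual c :=
  AddMonoidHom.mk' (fun l => conjDual (weylWord g β l)) (by
    intro l m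
    have h : weylWord g β (l + m) = weylWord g β l + weylWord g β m := by
      induction β with
      | nil => rfl
      | cons α β ih =>
        change reflect g α (weylWord g β (l + m))
          = reflect g α (weylWord g β l) + reflect g α (weylWord g β m)
        rw [ih]
        simp only [reflect, LinearMap.add_apply]
        module
    ext H
    simp [h, conjDual_apply])

theorem conjWord_apply (β : List (CDual c)) (l : CDual c) :
    conjWord g β l = conjDual (weylWord g β l) := rfl

theorem weylWord_mem {Φ : Set (CDual c)} {β : List (CDual c)}
    (hβ : ∀ α ∈ β, ∀ γ ∈ Φ, reflect g α γ ∈ Φ) {γ : CDual c} (hγ : γ ∈ Φ) :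
    weylWord g β γ ∈ Φ := by
  induction β with
  | nil => exact hγ
  | cons α β ih => exact hβ α (by simp) _ (ih fun δ hδ => hβ δ (by simp [hδ]))

theorem weylWord_injective {β : List (CDual c)}
    (hβ : ∀ α ∈ β, Function.Injective (reflect g α)) : Function.Injective (weylWord g β) := by
  induction β with
  | nil => exact fun _ _ h => h
  | cons α β ih => exact (hβ α (by simp)).comp (ih fun δ hδ => hβ δ (by simp [hδ]))

theorem weylWord_concat (β : List (CDual c)) (α l : CDual c) :
    weylWord g (β ++ [α]) l = weylWord g β (reflect g α l) := by
  simp [weylWord]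

theorem IsRun.isSimpleRoot {P : Set (CDual c)} {β : List (CDual c)} (h : IsRun g P β) :
    ∀ α ∈ β, IsSimpleRoot P α := by
  induction h with
  | nil => simp
  | snoc β α _ hα _ ih =>
    intro γ hγ
    rcases List.mem_append.1 hγ with h | h
    · exact ih γ h
    · rw [List.mem_singleton.1 h]; exact hα

end Weyl

end RealSemisimple

/-! ### The algorithm and its outputs -/

open RealSemisimple in
theorem corollary4p3 (n : ℕ) (g c : LieSubalgebra ℝ (Matrix (Fin n) (Fin n) ℝ))
    [LieAlgebra.IsSemisimple ℝ g] (hc : IsCartan g c)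
    (P : Set (Module.Dual ℂ (complexification c))) (hP : IsPositiveSystem g c P) :
    -- the algorithm always stops, and it has an output
    (∀ β, IsRun g P β → β.length ≤ {α ∈ P | -conjDual α ∈ P}.ncard) ∧
    (∃ β, IsOutput g P β) ∧
    -- every simple root has a standard copy of `𝔰𝔩(2, ℂ)`
    (∀ α, IsSimpleRoot P α → ∃ X Y, IsStandardPair g c α X Y) ∧
    ∀ β, IsOutput g P β →
      -- the product of the reflections maps the positive system to its conjugate
      conjDual '' (weylWord g β '' P) = P ∧
      weylWord g β '' P = conjDual '' P ∧
      ∀ X Y : Module.Dual ℂ (complexification c) → Matrix (Fin n) (Fin n) ℂ,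
        (∀ α, IsSimpleRoot P α → IsStandardPair g c α (X α) (Y α)) →
        -- `ω` lies in the normalizer of `𝔠^ℂ` in `G^ℂ`
        omega X Y β ∈ complexGroup g ∧
        conjugate (omega X Y β) (complexification c) = complexification c ∧
        -- `ω` represents the product of the reflections
        (∀ (l : Module.Dual ℂ (complexification c)) (H K : complexification c),
          (K : Matrix (Fin n) (Fin n) ℂ) =
            ((omega X Y β)⁻¹ : GL (Fin n) ℂ) * (H : Matrix (Fin n) (Fin n) ℂ) * omega X Y β →
          l K = weylWord g β l H) ∧
        -- `ω 𝔶 ω⁻¹ = σ(𝔶)`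
        conjugate (omega X Y β) (positiveSum g P) = conjMat '' (positiveSum g P) := by
  have := isCartanSubalgebra hc
  have := isKilling_complexification (g := g)
  have hΦ := isRootSet hc
  have hpos : IsPositive {α : CDual c | IsRoot g c α} P :=
    ⟨hP.isRoot, hP.mem_or_neg_mem, hP.neg_notMem, hP.add_mem⟩
  -- Each step trades one positive root made negative for one letter of the word, so this sum is
  -- invariant along a run.
  have hcount : ∀ β, IsRun g P β →
      {γ ∈ P | -conjWord g β γ ∈ P}.ncard + β.length = {α ∈ P | -conjDual α ∈ P}.ncard := by
    intro β hβ
    induction hβ with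
    | nil => rfl
    | snoc β α _ hα hneg ih =>
      have h1 := ncard_comp_reflection hΦ hpos hα (conjWord g β) hneg
      have h2 : {γ ∈ P | -conjWord g (β ++ [α]) γ ∈ P}
          = {γ ∈ P | -conjWord g β (γ - Module.Dual.eval ℂ _ (coroot g α) γ • α) ∈ P} := by
        simp only [conjWord_apply, weylWord_concat]
        rfl
      rw [h2, List.length_append, List.length_singleton, ← ih, ← add_assoc,
        add_right_comm]
      exact congrArg (· + β.length) h1
  have hlen : ∀ β, IsRun g P β → β.length ≤ {α ∈ P | -conjDual α ∈ P}.ncard := fun β hβ => by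
    have := hcount β hβ
    omega
  refine ⟨hlen, ?_, fun α hα => exists_isStandardPair hc.maximal.1.1 (hP.isRoot α hα.1), ?_⟩
  -- Without an output every run could be prolonged, giving runs of every length against the bound.
  · by_contra hcon
    have hlong : ∀ m : ℕ, ∃ β, IsRun g P β ∧ β.length = m := by
      intro m
      induction m with
      | zero => exact ⟨[], IsRun.nil, rfl⟩
      | succ m ih =>
        obtain ⟨β, hβ, rfl⟩ := ih
        have hext : ∃ α, IsSimpleRoot P α ∧ -conjDual (weylWord g β α) ∈ P := by
          by_contra h
          exact hcon ⟨β, hβ, h⟩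
        obtain ⟨α, hα, hneg⟩ := hext
        exact ⟨β ++ [α], hβ.snoc β α hα hneg, by simp⟩
    obtain ⟨β, hβ, hl⟩ := hlong ({α ∈ P | -conjDual α ∈ P}.ncard + 1)
    have := hlen β hβ
    omega
  · rintro β ⟨hrun, hterm⟩
    have hsimple := hrun.isSimpleRoot
    have hroot : ∀ α ∈ β, IsRoot g c α := fun α hα => hP.isRoot α (hsimple α hα).1
    have himg : conjWord g β '' P = P := by
      refine image_positive_eq hΦ hpos (conjWord g β) ?_ ?_ fun α hα h => hterm ⟨α, hα, h⟩
      · refine (Function.Involutive.injective conjDual_conjDual).comp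
          (weylWord_injective fun α hα => ?_)
        exact Function.Involutive.injective fun l => reflection_involutive hΦ (hroot α hα) l
      · intro γ hγ
        exact IsRoot.conjDual (weylWord_mem (Φ := {α : CDual c | IsRoot g c α})
          (fun α hα δ hδ => hΦ.reflection_mem α (hroot α hα) δ hδ) hγ)
    have h1 : conjDual '' (weylWord g β '' P) = P := by
      rw [Set.image_image]; exact himg
    have h2 : weylWord g β '' P = conjDual '' P := by
      conv_rhs => rw [← h1, Set.image_image]
      simp only [conjDual_conjDual, Set.image_id']
    refine ⟨h1, h2, fun X Y hXY => ?_⟩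
    have hrep : Represents g (omega X Y β) (weylWord g β) := represents_omega β fun α hα =>
      (hXY α (hsimple α hα)).represents
        ((hXY α (hsimple α hα)).lie_eq_coroot hc (hroot α hα))
    refine ⟨hrep.mem, hrep.conjugate_eq, fun l H K hK => ?_, ?_⟩
    · obtain ⟨K', hK', hu⟩ := hrep.exists_inv H
      have : K = K' := by
        apply Subtype.ext
        rw [hK, hK', conjL_apply, inv_inv]
      rw [this, hu]
    · change conjL (omega X Y β) '' _ = conjMatL '' _
      rw [← Submodule.map_coe, ← Submodule.map_coe]
      congr 1
      -- Both sides become suprema of root spaces, over the images of `P` under the Weyl word and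
      -- under `conjDual`; these images agree by `h2`.
      simp only [positiveSum, Submodule.map_iSup, hrep.map_rootSpace, map_conjMat_rootSpace]
      rw [← iSup_image (g := rootSpace g c), h2, iSup_image]
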